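/- Let $\le_{\mathrm T}$ and $\equiv_{\mathrm T}$ denote Turing reducibility and Turing equivalence on $2^\omega$, and let $\mathscr D_{\mathrm T}=2^\omega/{\equiv_{\mathrm T}}$ be the set of Turing degrees, with the ordering induced by $\le_{\mathrm T}$. An automorphism of $\mathscr D_{\mathrm T}$ is a bijection $\pi:\mathscr D_{\mathrm T}\to\mathscr D_{\mathrm T}$ such that $\mathbf x\le\mathbf y$ if and only if $\pi(\mathbf x)\le\pi(\mathbf y)$, for all $\mathbf x,\mathbf y\in\mathscr D_{\mathrm T}$. It is induced by a permutation $f:\omega\to\omega$ if $\pi([A]_{\equiv_{\mathrm T}})=[f^*(A)]_{\equiv_{\mathrm T}}$ for every $A\in 2^\omega$, where $f^*(A)(n)=A(f(n))$ for all $n\in\omega$. **Theorem.** If $\pi$ is an automorphism of $\mathscr D_{\mathrm T}$ which is induced by a permutation $f$ of $\omega$, then $f$ is recursive. -/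

import Mathlib

/-- Points of Cantor space `2^ω`, that is, subsets of `ω` given by their characteristic functions. -/
abbrev Cantor : Type := ℕ → Bool

namespace Cantor

/-- The characteristic function of `A`, with values `0` and `1`, as a (total) partial function, so
that Turing reducibility of functions applies to it. -/
def toPFun (A : Cantor) : ℕ →. ℕ := fun n => Part.some (A n).toNat

/-- The pullback `f^*` of `f : ω → ω`, on `2^ω`: `f^*(A)(n) = A(f(n))`. -/
def pullback (f : ℕ → ℕ) (A : Cantor) : Cantor := fun n => A (f n)

/-- Turing reducibility `A ≤_T B` of elements of `2^ω`. -/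
def TuringLE (A B : Cantor) : Prop := TuringReducible A.toPFun B.toPFun

theorem TuringLE.refl (A : Cantor) : A.TuringLE A := TuringReducible.refl _

theorem TuringLE.trans {A B C : Cantor} (h : A.TuringLE B) (h' : B.TuringLE C) : A.TuringLE C :=
  TuringReducible.trans h h'

/-- Turing equivalence `A ≡_T B` of elements of `2^ω`. -/
def turingSetoid : Setoid Cantor where
  r A B := A.TuringLE B ∧ B.TuringLE A
  iseqv :=
    { refl := fun A => ⟨TuringLE.refl A, TuringLE.refl A⟩
      symm := fun h => ⟨h.2, h.1⟩
      trans := fun h h' => ⟨h.1.trans h'.1, h'.2.trans h.2⟩ }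

/-- The set of Turing degrees `2^ω / ≡_T`. Mathlib's `TuringDegree` consists instead of the
degrees of arbitrary partial functions, used as partial oracles. -/
def Degree : Type := Quotient turingSetoid

/-- The Turing degree of `A`. -/
def degree (A : Cantor) : Degree := Quotient.mk turingSetoid A

/-- The ordering of the Turing degrees: `deg A ≤ deg B` iff `A ≤_T B`. -/
instance Degree.instPartialOrder : PartialOrder Degree where
  le := Quotient.lift₂ TuringLE fun _ _ _ _ hA hB =>
    propext ⟨fun h => (hA.2.trans h).trans hB.1, fun h => (hA.1.trans h).trans hB.2⟩
  le_refl a := Quotient.inductionOn a TuringLE.refl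
  le_trans a b c := Quotient.inductionOn₃ a b c fun _ _ _ h h' => TuringLE.trans h h'
  le_antisymm a b := Quotient.inductionOn₂ a b fun _ _ h h' => Quotient.sound ⟨h, h'⟩

theorem degree_le_degree {A B : Cantor} : degree A ≤ degree B ↔ A.TuringLE B := Iff.rfl

theorem degree_eq_degree {A B : Cantor} :
    degree A = degree B ↔ A.TuringLE B ∧ B.TuringLE A :=
  ⟨fun h => Quotient.exact h, fun h => Quotient.sound h⟩

/-- A map `π` on the Turing degrees is induced by `f : ω → ω` if `π (deg A) = deg (f^*(A))` for all
`A`. -/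
def IsInducedBy (π : Degree → Degree) (f : ℕ → ℕ) : Prop :=
  ∀ A : Cantor, π (degree A) = degree (pullback f A)

end Cantor

open Filter Nat.Partrec

namespace Cantor

/-- The initial segment of length `t` of `C`. -/
def initSeg (C : Cantor) (t : ℕ) : List Bool := (List.range t).map C

@[simp] theorem length_initSeg (C : Cantor) (t : ℕ) : (C.initSeg t).length = t := by
  simp [initSeg]

theorem getElem?_initSeg (C : Cantor) {t i : ℕ} (h : i < t) : (C.initSeg t)[i]? = some (C i) := by
  simp [initSeg, h]

theorem initSeg_prefix (C : Cantor) {s t : ℕ} (h : s ≤ t) : C.initSeg s <+: C.initSeg t := by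
  obtain ⟨r, rfl⟩ := Nat.exists_eq_add_of_le h
  simp [initSeg, List.range_add]

/-- A family of partial functions indexed by binary strings is monotone if extending the string
preserves the values. -/
def MonotoneFunctional (Φ : List Bool → ℕ →. ℕ) : Prop :=
  ∀ ⦃l l' : List Bool⦄, l <+: l' → ∀ ⦃n m : ℕ⦄, m ∈ Φ l n → m ∈ Φ l' n

/-- A partial function recursive in `C` is approximated by a monotone partial recursive functional
on the initial segments of `C`. -/
theorem exists_functional {C : Cantor} {g : ℕ →. ℕ} (hg : Nat.RecursiveIn {C.toPFun} g) :
    ∃ Φ : List Bool → ℕ →. ℕ, Partrec₂ Φ ∧ MonotoneFunctional Φ ∧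
      ∀ n m, m ∈ g n → ∀ᶠ t in atTop, m ∈ Φ (C.initSeg t) n := by
  induction hg with
  | zero =>
    exact ⟨fun _ _ => Part.some 0, (Computable.const 0).partrec, fun _ _ _ _ _ h => h,
      fun _ _ h => .of_forall fun _ => h⟩
  | succ =>
    exact ⟨fun _ n => Part.some n.succ, (Computable.succ.comp Computable.snd).partrec,
      fun _ _ _ _ _ h => h, fun _ _ h => .of_forall fun _ => h⟩
  | left =>
    exact ⟨fun _ n => Part.some n.unpair.1,
      (Computable.fst.comp (Primrec.unpair.to_comp.comp Computable.snd)).partrec,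
      fun _ _ _ _ _ h => h, fun _ _ h => .of_forall fun _ => h⟩
  | right =>
    exact ⟨fun _ n => Part.some n.unpair.2,
      (Computable.snd.comp (Primrec.unpair.to_comp.comp Computable.snd)).partrec,
      fun _ _ _ _ _ h => h, fun _ _ h => .of_forall fun _ => h⟩
  | oracle g hg =>
    obtain rfl : g = C.toPFun := hg
    refine ⟨fun l n => Part.ofOption (l[n]?.map Bool.toNat), ?_, ?_, ?_⟩
    · exact Computable.ofOption (Computable.option_map
        (Computable.list_getElem?.comp Computable.fst Computable.snd)
        ((Primrec.dom_bool Bool.toNat).to_comp.comp Computable.snd).to₂)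
    · rintro l _ ⟨r, rfl⟩ n m h
      simp only [Part.mem_ofOption, Option.mem_def, Option.map_eq_some_iff] at h ⊢
      obtain ⟨b, hb, rfl⟩ := h
      refine ⟨b, ?_, rfl⟩
      rw [List.getElem?_append_left (List.getElem?_eq_some_iff.1 hb).1, hb]
    · intro n m h
      filter_upwards [eventually_gt_atTop n] with t ht
      rw [getElem?_initSeg C ht]
      simpa [toPFun, eq_comm] using h
  | pair _ _ ihf ihh =>
    obtain ⟨Φ, hΦ, mΦ, cΦ⟩ := ihf
    obtain ⟨Ψ, hΨ, mΨ, cΨ⟩ := ihh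
    refine ⟨fun l n => (Φ l n).bind fun x => (Ψ l n).map fun y => Nat.pair x y, ?_, ?_, ?_⟩
    · exact hΦ.bind ((hΨ.comp (Computable.fst.comp Computable.fst)
        (Computable.snd.comp Computable.fst)).map
        (Primrec₂.natPair.to_comp.comp (Computable.snd.comp Computable.fst) Computable.snd).to₂)
    · intro l l' h n m hm
      simp only [Part.mem_bind_iff, Part.mem_map_iff] at hm ⊢
      obtain ⟨x, hx, y, hy, e⟩ := hm
      exact ⟨x, mΦ h hx, y, mΨ h hy, e⟩
    · intro n m hm
      simp only [Seq.seq, Part.map_eq_map, Part.bind_map, Part.mem_bind_iff,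
        Part.mem_map_iff] at hm
      obtain ⟨x, hx, y, hy, e⟩ := hm
      filter_upwards [cΦ _ _ hx, cΨ _ _ hy] with t h1 h2
      simp only [Part.mem_bind_iff, Part.mem_map_iff]
      exact ⟨x, h1, y, h2, e⟩
  | comp _ _ ihf ihh =>
    obtain ⟨Φ, hΦ, mΦ, cΦ⟩ := ihf
    obtain ⟨Ψ, hΨ, mΨ, cΨ⟩ := ihh
    refine ⟨fun l n => (Ψ l n).bind (Φ l), ?_, ?_, ?_⟩
    · exact hΨ.bind (hΦ.comp (Computable.fst.comp Computable.fst) Computable.snd)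
    · intro l l' h n m hm
      obtain ⟨x, hx, hy⟩ := Part.mem_bind_iff.1 hm
      exact Part.mem_bind_iff.2 ⟨x, mΨ h hx, mΦ h hy⟩
    · intro n m hm
      obtain ⟨x, hx, hy⟩ := Part.mem_bind_iff.1 hm
      filter_upwards [cΨ _ _ hx, cΦ _ _ hy] with t h1 h2
      exact Part.mem_bind_iff.2 ⟨x, h1, h2⟩
  | prec _ _ ihf ihh =>
    obtain ⟨Φ, hΦ, mΦ, cΦ⟩ := ihf
    obtain ⟨Ψ, hΨ, mΨ, cΨ⟩ := ihh
    refine ⟨fun l p => p.unpair.2.rec (Φ l p.unpair.1) fun y IH => IH.bind fun i =>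
      Ψ l (Nat.pair p.unpair.1 (Nat.pair y i)), ?_, ?_, ?_⟩
    · have hu : Computable fun q : List Bool × ℕ => q.2.unpair :=
        Primrec.unpair.to_comp.comp Computable.snd
      refine Partrec.nat_rec (h := fun q z => Ψ q.1 (Nat.pair q.2.unpair.1 (Nat.pair z.1 z.2)))
        (Computable.snd.comp hu) (hΦ.comp Computable.fst (Computable.fst.comp hu)) ?_
      exact hΨ.comp (Computable.fst.comp Computable.fst)
        (Primrec₂.natPair.to_comp.comp (Computable.fst.comp (hu.comp Computable.fst))
          (Primrec₂.natPair.to_comp.comp (Computable.fst.comp Computable.snd)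
            (Computable.snd.comp Computable.snd)))
    · intro l l' h p
      dsimp only
      induction p.unpair.2 with
      | zero => exact fun m hm => mΦ h hm
      | succ y ih =>
        intro m hm
        obtain ⟨x, hx, hy⟩ := Part.mem_bind_iff.1 hm
        exact Part.mem_bind_iff.2 ⟨x, ih hx, mΨ h hy⟩
    · intro p
      dsimp only
      induction p.unpair.2 with
      | zero => exact fun m hm => cΦ _ _ hm
      | succ y ih =>
        intro m hm
        obtain ⟨x, hx, hy⟩ := Part.mem_bind_iff.1 hm
        filter_upwards [ih _ hx, cΨ _ _ hy] with t h1 h2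
        exact Part.mem_bind_iff.2 ⟨x, h1, h2⟩
  | @rfind g _ ihf =>
    obtain ⟨Φ, hΦ, mΦ, cΦ⟩ := ihf
    refine ⟨fun l a => Nat.rfind fun n => (Φ l (Nat.pair a n)).map fun m => decide (m = 0),
      ?_, ?_, ?_⟩
    · refine Partrec.rfind ((hΦ.comp (Computable.fst.comp Computable.fst)
        (Primrec₂.natPair.to_comp.comp (Computable.snd.comp Computable.fst) Computable.snd)).map ?_)
      exact (Primrec.eq.decide.comp Primrec.snd (Primrec.const 0)).to_comp.to₂
    · intro l l' h n m hm
      obtain ⟨ha, hk⟩ := Nat.mem_rfind.1 hm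
      have step : ∀ {i b}, b ∈ (Φ l (Nat.pair n i)).map (fun m => decide (m = 0)) →
          b ∈ (Φ l' (Nat.pair n i)).map (fun m => decide (m = 0)) := fun hb => by
        obtain ⟨a, ha, e⟩ := (Part.mem_map_iff _).1 hb
        exact (Part.mem_map_iff _).2 ⟨a, mΦ h ha, e⟩
      exact Nat.mem_rfind.2 ⟨step ha, fun hkm => step (hk hkm)⟩
    · intro n m hm
      obtain ⟨ha, hk⟩ := Nat.mem_rfind.1 hm
      have step : ∀ {i b}, b ∈ (fun m => decide (m = 0)) <$> g (Nat.pair n i) →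
          ∀ᶠ t in atTop,
            b ∈ (Φ (C.initSeg t) (Nat.pair n i)).map (fun m => decide (m = 0)) := fun hb => by
        obtain ⟨a, ha, e⟩ := (Part.mem_map_iff _).1 hb
        exact (cΦ _ _ ha).mono fun t ht => (Part.mem_map_iff _).2 ⟨a, ht, e⟩
      filter_upwards [step ha,
        (eventually_all_finite (Set.finite_Iio m)).2 fun k hkm => step (hk hkm)] with t h1 h2
      exact Nat.mem_rfind.2 ⟨h1, fun {k} hkm => h2 k hkm⟩

/-- The functional computed by a code. -/
def codeFunctional (c : Code) (l : List Bool) (n : ℕ) : Part ℕ :=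
  c.eval (Encodable.encode (l, n))

theorem exists_code {C : Cantor} {g : ℕ →. ℕ} (hg : Nat.RecursiveIn {C.toPFun} g) :
    ∃ c : Code, MonotoneFunctional (codeFunctional c) ∧
      ∀ n m, m ∈ g n → ∀ᶠ t in atTop, m ∈ codeFunctional c (C.initSeg t) n := by
  obtain ⟨Φ, hΦ, h⟩ := exists_functional hg
  obtain ⟨c, hc⟩ := Code.exists_code.1 hΦ
  have : codeFunctional c = Φ := by
    funext l n
    rw [codeFunctional, hc]
    simp [Part.map_id']
  exact ⟨c, this ▸ h⟩

/-- The code `c` computes `D ∘ k` from `D`. -/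
def Computes (c : Code) (k : ℕ → ℕ) (D : Cantor) : Prop :=
  ∀ n, ∀ᶠ t in atTop, (D (k n)).toNat ∈ codeFunctional c (D.initSeg t) n

/-- If `C ∘ k` is recursive in `C` for all `C`, then a single code computes `D ∘ k` from `D` for a
somewhere dense set of `D`. -/
theorem exists_code_somewhere_dense {k : ℕ → ℕ} (hk : ∀ C : Cantor, (pullback k C).TuringLE C) :
    ∃ (c : Code) (σ : List Bool), MonotoneFunctional (codeFunctional c) ∧
      ∀ l, σ <+: l → ∃ D : Cantor, D.initSeg l.length = l ∧ Computes c k D := by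
  let S : Code → Set Cantor := fun c =>
    {D | MonotoneFunctional (codeFunctional c) ∧ Computes c k D}
  have hS : ⋃ c, closure (S c) = Set.univ := by
    refine Set.eq_univ_of_forall fun C => Set.mem_iUnion.2 ?_
    obtain ⟨c, hc, h⟩ := exists_code (RecursiveIn.iff_nat.1 (hk C))
    exact ⟨c, subset_closure ⟨hc, fun n => h n _ (Part.mem_some _)⟩⟩
  have : Countable Code := Encodable.countable
  obtain ⟨c, C, hC⟩ := nonempty_interior_of_iUnion_of_closed (fun c => isClosed_closure) hS
  obtain ⟨I, u, hu, hI⟩ := isOpen_pi_iff.1 isOpen_interior C hC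
  obtain ⟨E, hE⟩ := closure_nonempty_iff.1 ⟨C, interior_subset hC⟩
  refine ⟨c, C.initSeg (I.sup id + 1), hE.1, ?_⟩
  rintro l ⟨r, hr⟩
  let B : Cantor := fun i => l[i]?.getD false
  have hB : B ∈ closure (S c) := by
    refine interior_subset (hI fun i hi => ?_)
    have hlt : i < I.sup id + 1 := Nat.lt_succ_of_le (Finset.le_sup (f := id) hi)
    have : B i = C i := by
      simp only [B]
      rw [← hr, List.getElem?_append_left (by simpa using hlt), getElem?_initSeg C hlt]
      rfl
    rw [this]
    exact (hu i hi).2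
  have hopen : IsOpen {D : Cantor | ∀ i ∈ Set.Iio l.length, D i = B i} := by
    have : {D : Cantor | ∀ i ∈ Set.Iio l.length, D i = B i} =
        ⋂ i ∈ Set.Iio l.length, (fun D : Cantor => D i) ⁻¹' {B i} := by
      ext D
      simp
    rw [this]
    exact (Set.finite_Iio _).isOpen_biInter fun i _ =>
      (isOpen_discrete {B i}).preimage (continuous_apply i)
  obtain ⟨D, hD, hDS⟩ := mem_closure_iff.1 hB _ hopen fun i _ => rfl
  refine ⟨D, List.ext_getElem? fun i => ?_, hDS.2⟩
  rcases lt_or_ge i l.length with hi | hi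
  · rw [getElem?_initSeg D hi, hD i hi]
    simp [B, hi]
  · simp [hi]

/-- One step of the search for two strings extending `σ`, differing in a single bit, on which `c`
gives different values. -/
def searchStep (c : Code) (σ : List Bool) (n m : ℕ) : Option ℕ :=
  (Encodable.decode (α := ℕ × List Bool × List Bool) m).bind fun q =>
    bif decide (c.evaln q.1 (Encodable.encode (σ ++ q.2.1 ++ [false] ++ q.2.2, n)) = some 0) &&
        decide (c.evaln q.1 (Encodable.encode (σ ++ q.2.1 ++ [true] ++ q.2.2, n)) = some 1)
    then some (σ ++ q.2.1).length else none

theorem computable_searchStep (c : Code) (σ : List Bool) : Computable₂ (searchStep c σ) := by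
  have h : ∀ (b : Bool) (j : ℕ), Primrec fun p : (ℕ × ℕ) × ℕ × List Bool × List Bool =>
      decide (c.evaln p.2.1 (Encodable.encode (σ ++ p.2.2.1 ++ [b] ++ p.2.2.2, p.1.1)) =
        some j) := by
    intro b j
    refine Primrec.eq.decide.comp ?_ (Primrec.const (some j))
    refine Code.primrec_evaln.comp (((Primrec.fst.comp Primrec.snd).pair (Primrec.const c)).pair ?_)
    refine Primrec.encode.comp (Primrec.pair ?_ (Primrec.fst.comp Primrec.fst))
    exact Primrec.list_append.comp (Primrec.list_append.comp (Primrec.list_append.comp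
      (Primrec.const σ) (Primrec.fst.comp (Primrec.snd.comp Primrec.snd))) (Primrec.const [b]))
      (Primrec.snd.comp (Primrec.snd.comp Primrec.snd))
  refine Primrec.to_comp (Primrec.option_bind (Primrec.decode.comp Primrec.snd) ?_)
  refine Primrec.cond (Primrec.and.comp (h false 0) (h true 1)) ?_ (Primrec.const none)
  exact Primrec.option_some.comp (Primrec.list_length.comp (Primrec.list_append.comp
    (Primrec.const σ) (Primrec.fst.comp (Primrec.snd.comp Primrec.snd))))

theorem mem_searchStep {c : Code} {σ : List Bool} {n x : ℕ} :
    (∃ m, x ∈ searchStep c σ n m) ↔ ∃ a b, x = (σ ++ a).length ∧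
      0 ∈ codeFunctional c (σ ++ a ++ [false] ++ b) n ∧
      1 ∈ codeFunctional c (σ ++ a ++ [true] ++ b) n := by
  constructor
  · rintro ⟨m, hm⟩
    simp only [searchStep, Option.mem_def, Option.bind_eq_some_iff, Bool.cond_eq_ite,
      Bool.and_eq_true, decide_eq_true_eq, Option.ite_none_right_eq_some, Option.some.injEq] at hm
    obtain ⟨⟨s, a, b⟩, -, ⟨h0, h1⟩, hx⟩ := hm
    exact ⟨a, b, hx.symm, Code.evaln_sound h0, Code.evaln_sound h1⟩
  · rintro ⟨a, b, rfl, h0, h1⟩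
    obtain ⟨s, hs⟩ := Code.evaln_complete.1 h0
    obtain ⟨s', hs'⟩ := Code.evaln_complete.1 h1
    refine ⟨Encodable.encode (max s s', a, b), ?_⟩
    have e0 := Code.evaln_mono (le_max_left s s') hs
    have e1 := Code.evaln_mono (le_max_right s s') hs'
    rw [Option.mem_def] at e0 e1
    simp only [searchStep, Encodable.encodek, Option.bind_some, e0, e1]
    simp

/-- If `C ∘ k` is recursive in `C` for all `C`, then a partial recursive function computes `k`
wherever its values are large. -/
theorem exists_partrec_of_forall_pullback_le {k : ℕ → ℕ}
    (hk : ∀ C : Cantor, (pullback k C).TuringLE C) :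
    ∃ (P : ℕ →. ℕ) (s : ℕ), Partrec P ∧ ∀ n, s ≤ k n → k n ∈ P n := by
  obtain ⟨c, σ, hc, hσ⟩ := exists_code_somewhere_dense hk
  refine ⟨fun n => Nat.rfindOpt (searchStep c σ n), σ.length,
    Partrec.rfindOpt (computable_searchStep c σ), fun n hn => ?_⟩
  have value : ∀ {l m}, σ <+: l → m ∈ codeFunctional c l n →
      ∀ b, l[k n]? = some b → m = b.toNat := by
    intro l m hl hm b hb
    obtain ⟨D, hD, hDk⟩ := hσ l hl
    obtain ⟨t, ht, htl⟩ := ((hDk n).and (eventually_ge_atTop l.length)).exists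
    have hlt := (List.getElem?_eq_some_iff.1 hb).1
    rw [← hD, getElem?_initSeg D hlt, Option.some.injEq] at hb
    rw [← hb]
    exact Part.mem_unique (hc (hD ▸ D.initSeg_prefix htl) hm) ht
  have sound : ∀ {x m}, x ∈ searchStep c σ n m → x = k n := by
    intro x m hx
    obtain ⟨a, b, rfl, h0, h1⟩ := mem_searchStep.1 ⟨m, hx⟩
    by_contra hne
    let r := List.replicate (k n + 1) true
    have hpre : ∀ e, σ <+: σ ++ a ++ [e] ++ b ++ r := fun e => by simp
    have hlt : ∀ e, k n < (σ ++ a ++ [e] ++ b ++ r).length := fun e => by simp [r]; omega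
    have heq : (σ ++ a ++ [false] ++ b ++ r)[k n]? = (σ ++ a ++ [true] ++ b ++ r)[k n]? := by
      simp only [List.append_assoc _ [_], List.append_assoc _ ([_] ++ _)]
      rcases lt_or_gt_of_ne hne with h | h
      · obtain ⟨j, hj⟩ := Nat.exists_eq_add_of_lt h
        rw [List.getElem?_append_right h.le, List.getElem?_append_right h.le]
        rw [show k n - (σ ++ a).length = j + 1 by omega]
        simp
      · rw [List.getElem?_append_left h, List.getElem?_append_left h]
    have v0 := value (hpre false) (hc (List.prefix_append _ _) h0) _
      (List.getElem?_eq_getElem (hlt false))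
    have v1 := value (hpre true) (hc (List.prefix_append _ _) h1) _
      (heq ▸ List.getElem?_eq_getElem (hlt false))
    exact absurd (v0.trans v1.symm) (by simp)
  have complete : ∃ m, k n ∈ searchStep c σ n m := by
    rw [mem_searchStep]
    let a := List.replicate (k n - σ.length) false
    have ha : k n = (σ ++ a).length := by simp [a]; omega
    have extend : ∀ (e : Bool) (b : List Bool), ∃ b',
        e.toNat ∈ codeFunctional c (σ ++ a ++ [e] ++ (b ++ b')) n := by
      intro e b
      obtain ⟨D, hD, hDk⟩ := hσ (σ ++ a ++ [e] ++ b) (by simp)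
      obtain ⟨t, ht, htl⟩ :=
        ((hDk n).and (eventually_ge_atTop (σ ++ a ++ [e] ++ b).length)).exists
      obtain ⟨b', hb'⟩ := hD ▸ D.initSeg_prefix htl
      have hbit : (σ ++ a ++ [e] ++ b)[k n]? = some e := by
        rw [ha, List.append_assoc _ [e], List.getElem?_append_right le_rfl]
        simp
      have hlt := (List.getElem?_eq_some_iff.1 hbit).1
      rw [← hD, getElem?_initSeg D hlt, Option.some.injEq] at hbit
      refine ⟨b', ?_⟩
      rw [← List.append_assoc, hb']
      rwa [hbit] at ht
    obtain ⟨b, hb⟩ := extend false []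
    obtain ⟨b', hb'⟩ := extend true b
    exact ⟨a, b ++ b', ha, hc (by simp) hb, hb'⟩
  obtain ⟨m, hm⟩ := complete
  have hdom : (Nat.rfindOpt (searchStep c σ n)).Dom := Nat.rfindOpt_dom.2 ⟨m, _, hm⟩
  obtain ⟨m', hm'⟩ := Nat.rfindOpt_spec (Part.get_mem hdom)
  exact sound hm' ▸ Part.get_mem hdom

end Cantor

/-- The inverse of a computable permutation of `ℕ` is computable. -/
theorem Computable.perm_symm {e : Equiv.Perm ℕ} (he : Computable e) : Computable e.symm := by
  have hp : Partrec₂ fun (n i : ℕ) => (Part.some (decide (e i = n)) : Part Bool) :=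
    (Primrec.eq.decide.to_comp.comp (he.comp Computable.snd) Computable.fst).partrec
  refine (Partrec.rfind hp).of_eq_tot fun n => Nat.mem_rfind.2 ⟨by simp, fun {m} hm => ?_⟩
  have : e m ≠ n := fun h => hm.ne (e.symm_apply_apply m ▸ congrArg e.symm h)
  simp [this]

/-- If a partial recursive function maps `g i` to `g (i + 1)` for all large `i`, then `g` is
computable. -/
theorem Computable.of_eventually_step {g : ℕ → ℕ} {P : ℕ →. ℕ} (hP : Partrec P)
    (h : ∀ᶠ i in atTop, g (i + 1) ∈ P (g i)) : Computable g := by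
  obtain ⟨N, hN⟩ := eventually_atTop.1 h
  have htail : Computable fun i => g (N + i) := by
    have hrec : Partrec fun i : ℕ => (i.rec (Part.some (g N)) fun _ IH => IH.bind P : Part ℕ) :=
      Partrec.nat_rec (h := fun _ q => P q.2) Computable.id (Computable.const (g N)).partrec
        (hP.comp (Computable.snd.comp Computable.snd)).to₂
    refine hrec.of_eq_tot fun i => ?_
    induction i with
    | zero => exact Part.mem_some _
    | succ i ih => exact Part.mem_bind_iff.2 ⟨_, ih, hN (N + i) (by omega)⟩
  have htable : Computable fun i => (((List.range N).map g)[i]?).getD (g (N + (i - N))) :=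
    Computable.option_getD (Computable.list_getElem?.comp (Computable.const _) Computable.id)
      (htail.comp (Primrec.nat_sub.to_comp.comp Computable.id (Computable.const N)))
  refine htable.of_eq fun i => ?_
  rcases lt_or_ge i N with hi | hi
  · simp [hi]
  · simp [hi]

/-- If an automorphism of the Turing degrees is induced by a permutation `f` of `ω`, then `f` is
recursive. -/
theorem mainTheorem2 (f : Equiv.Perm ℕ) (π : Cantor.Degree ≃o Cantor.Degree)
    (hπ : Cantor.IsInducedBy π f) : Computable (f : ℕ → ℕ) := by
  have shift : ∀ B : Cantor, (Cantor.pullback Nat.succ B).TuringLE B := fun B => by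
    have h := (Nat.RecursiveIn.oracle (O := {B.toPFun}) _ rfl).comp .succ
    refine RecursiveIn.iff_nat.2 (h.of_eq fun n => ?_)
    exact Part.bind_some _ _
  have hk : ∀ C : Cantor, (Cantor.pullback (fun n => f.symm (f n + 1)) C).TuringLE C := by
    intro C
    let B := Cantor.pullback f.symm C
    have h := π.monotone (Cantor.degree_le_degree.2 (shift B))
    rw [hπ, hπ, Cantor.degree_le_degree] at h
    have hB : Cantor.pullback f B = C := by
      funext n
      simp [B, Cantor.pullback]
    rwa [hB] at h
  obtain ⟨P, s, hP, hs⟩ := Cantor.exists_partrec_of_forall_pullback_le hk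
  have hsymm : Computable f.symm := by
    refine Computable.of_eventually_step hP ?_
    have hlarge := f.symm.injective.nat_tendsto_atTop.eventually (eventually_ge_atTop s)
    filter_upwards [(tendsto_add_atTop_nat 1).eventually hlarge] with i hi
    simpa using hs (f.symm i) (by simpa using hi)
  exact hsymm.perm_symm
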